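/- Let $k\ge 1$ and let $G=(V,E)$ be a finite graph. A $k$-colored partition of $G$ is a partition $V=V_1\cup\dots\cup V_s$, $s\ge 1$, into nonempty blocks together with a coloring of the vertices with $k$ colors such that each $V_i$ induces a connected subgraph, all vertices of $V_i$ have the same color, and any two different blocks joined by an edge have different colors. Its size $\rho(T)$ is the number $s$ of blocks. Let $K_{1,3}$ be the star with one center and three leaves, $P_n$ the path with $n$ vertices, and $K_{1,3}\times P_n$ their Cartesian product (two vertices are adjacent if they agree in one coordinate and are adjacent in the other). The last slice is the copy of $K_{1,3}$ at the last vertex of $P_n$. Put $$T(x,y)=\sum_{n\ge 1}x^n\sum_{T}y^{\rho(T)},$$ where the inner sum is over all 2-colored partitions $T$ of $K_{1,3}\times P_n$. For $1\le i\le 7$ let $T_i(x,y)$ be the same sum restricted to the 2-colored partitions whose last slice is in the following configuration $i$. The center and the three leaves have prescribed colors, and it is prescribed which of these four vertices lie in a common block of the whole partition (possibly connected only through other slices); the center has color $0$, the leaves of color $0$ lie in the block of the center, and the leaves of color $1$ are as follows: (1) all three leaves, in three different blocks; (2) all three leaves, the first two in one block and the third in another block; (3) all three leaves, in one block; (4)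 the first two leaves, in different blocks; (5) the first two leaves, in one block; (6) the first leaf only; (7) none. **Theorem.** As formal power series in $x$ over $\mathbb{Q}(y)$, $$T(x,y)=\frac{p(x,y)}{q(x,y)},$$ where \begin{align*} p(x,y) &=(2y^4 + 6y^3 + 6y^2 + 2y)x + (-8y^7 + 4y^6 - 28y^5 + 40y^4 - 44y^3 + 4y^2 - 16y)x^2+\\ & (14y^9 - 22y^8 - 4y^7 + 104y^6 - 106y^5 - 32y^4 + 90y^3 - 52y^2 + 40y)x^3+\\ & (-8y^{10} - 8y^9 + 124y^8 - 204y^7 + 52y^6 + 64y^5 + 16y^4 - 80y^3 + 92y^2 - 48y)x^4 +\\ &(-10y^{11} + 4y^{10} + 110y^9 - 268y^8 + 112y^7 + 384y^6 - 662y^5 + 468y^4 - 120y^3 - 48y^2 + 30y)x^5 +\\ &(16y^{11} - 28y^{10} - 156y^9 + 656y^8 - 1028y^7 + 708y^6 - 316y^4 + 168y^3 - 12y^2 - 8y)x^6 +\\ &(8y^{11} - 58y^{10} + 228y^9 - 562y^8 + 852y^7 - 756y^6 + 340y^5 - 26y^4 - 36y^3 + 10y^2)x^7, \end{align*} and \begin{align*}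 q(x,y) &= 1 + (-y^4 - y^3 - y^2 - 7y - 9)x + (y^7 + y^6 + 5y^5 + 11y^4 - 4y^3 - 6y^2 + 14y + 28)x^2 +\\ &(-y^9 - 3y^8 + y^7 + 5y^6 - 22y^5 - 11y^4 + 7y^3 + 54y^2 - 18y - 44)x^3 +\\ &(7y^9 - 17y^8 + 2y^7 + 20y^6 - 32y^5 + 45y^4 + 42y^3 - 105y^2 - y + 39)x^4 +\\ &(y^{11} + 4y^{10} - 24y^9 + 47y^8 - 28y^7 - 62y^6 + 167y^5 - 125y^4 - 50y^3 + 83y^2 + 6y - 19)x^5 +\\ &(y^{11} - 24y^{10} + 94y^9 - 122y^8 - 61y^7 + 365y^6 - 409y^5 + 116y^4 + 116y^3 - 91y^2 + 11y + 4)x^6 +\\ &(-3y^{11} + 23y^{10} - 74y^9 + 95y^8 + 45y^7 - 289y^6 + 355y^5 - 183y^4 + 18y^3 + 18y^2 - 5y)x^7. \end{align*} Both $p$ and $q$ have degree $7$ in $x$. Moreover, $$T=2\left(T_1+3T_2+T_3+3T_4+3T_5+3T_6+T_7\right),$$ and the vector $\mathbf t=(T_1,\dots,T_7)^{\top}$ satisfies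 $\mathbf t=\mathbf b+x\mathcal R\,\mathbf t$ with $\mathbf b=(xy^4,0,0,xy^3,0,xy^2,xy)^{\top}$ and $$\mathcal R=\left(\begin{array}{rrrrrrr} y^{4} + 1 & 3 y^{4} & y^{4} & 3 y^{3} + 3 y & 3 y^{3} & 3 y^{2} & y^{3} \\ 0 & 1 & 0 & 0 & y & y^{2} & 0 \\ 0 & 0 & 1 & 0 & 0 & 0 & y \\ y^{2} + 1 & 3 y^{2} + 2 & y^{2} & y^{3} + 4 y + 1 & y^{3} + 4 y & 3 y^{2} + 2 y & y^{2} \\ 0 & 1 & 1 & 0 & 1 & 1 & y \\ 2 & y + 5 & y + 1 & \frac{3 y^{2} + 2 y + 1}{y} & 3 y + 3 & y^{2} + 2 y + 3 & 2 y \\ \frac{y^{2} + 1}{y^{2}} & \frac{3 y + 3}{y} & 2 & \frac{3 y + 3}{y} & 6 & 6 & y + 1 \end{array}\right).$$ -/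

import Mathlib

open scoped PowerSeries

/-- A `k`-colored partition of a graph `G`: a partition of the vertex set into at least one block
(given by an equivalence relation, whose classes are the blocks) and a coloring of the vertices,
such that each block induces a connected subgraph, each block is monochromatic, and any two
different blocks that are joined by an edge have different colors. -/
@[ext]
structure ColoredPartition {V : Type*} (G : SimpleGraph V) (k : ℕ) where
  blocks : Setoid V
  color : V → Fin k
  nonempty : blocks.classes.Nonempty
  connected : ∀ B ∈ blocks.classes, (G.induce B).Connected
  monochromatic : ∀ B ∈ blocks.classes, ∀ u ∈ B, ∀ v ∈ B, color u = color v
  neighbors : ∀ B ∈ blocks.classes, ∀ C ∈ blocks.classes, B ≠ C →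
    (∃ u ∈ B, ∃ v ∈ C, G.Adj u v) → ∀ u ∈ B, ∀ v ∈ C, color u ≠ color v

namespace ColoredPartition

/-- The size of a colored partition: its number of blocks. -/
noncomputable def size {V : Type*} {G : SimpleGraph V} {k : ℕ} (P : ColoredPartition G k) : ℕ :=
  P.blocks.classes.ncard

instance {V : Type*} [Finite V] (G : SimpleGraph V) (k : ℕ) : Finite (ColoredPartition G k) := by
  have h : Function.Injective (fun P : ColoredPartition G k =>
      ((fun u v => P.blocks u v : V → V → Prop), P.color)) := by
    intro P Q hPQ
    simp only [Prod.mk.injEq] at hPQ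
    refine ColoredPartition.ext (Setoid.ext fun u v => ?_) hPQ.2
    exact iff_of_eq (congrFun (congrFun hPQ.1 u) v)
  exact Finite.of_injective _ h

noncomputable instance {V : Type*} [Finite V] (G : SimpleGraph V) (k : ℕ) :
    Fintype (ColoredPartition G k) := Fintype.ofFinite _

end ColoredPartition

/-- The star graph `K_{1,3}`; the vertex `Sum.inl 0` is its center. -/
abbrev star : SimpleGraph (Fin 1 ⊕ Fin 3) := completeBipartiteGraph (Fin 1) (Fin 3)

/-- The product `K_{1,3} × P_n`. -/
abbrev starPath (n : ℕ) : SimpleGraph ((Fin 1 ⊕ Fin 3) × Fin n) :=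
  star □ SimpleGraph.pathGraph n

/-- The field `ℚ(y)` of coefficients; the generating functions are power series in `x` over it. -/
abbrev Coeffs : Type := RatFunc ℚ

/-- The variable `y`, which marks the number of blocks. -/
noncomputable abbrev yVar : Coeffs := RatFunc.X

/-- The generating function `∑ₙ xⁿ ∑_T y ^ size T`, where `T` runs over the 2-colored partitions of
`K_{1,3} × P_n`. (For `n = 0` the graph has no vertices, hence no partition into at least one
block, and the inner sum is empty.) -/
noncomputable def starGF : Coeffs⟦X⟧ :=
  PowerSeries.mk fun n => ∑ T : ColoredPartition (starPath n) 2, yVar ^ T.size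

/-- The colors of the four vertices of the last slice in the configurations `T₁, …, T₇`:
the center has color `0` and the leaves have the listed colors. -/
def sliceColor (i : Fin 7) : Fin 1 ⊕ Fin 3 → Fin 2 :=
  Sum.elim (fun _ => 0)
    ((![![1, 1, 1], ![1, 1, 1], ![1, 1, 1], ![1, 1, 0], ![1, 1, 0], ![1, 0, 0], ![0, 0, 0]] :
      Fin 7 → Fin 3 → Fin 2) i)

/-- The blocks of the four vertices of the last slice in the configurations `T₁, …, T₇`:
the center has label `0`, the leaves have the listed labels, and two vertices of the slice lie in
the same block of the whole partition if and only if they have equal labels. -/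
def sliceLabel (i : Fin 7) : Fin 1 ⊕ Fin 3 → ℕ :=
  Sum.elim (fun _ => 0)
    ((![![1, 2, 3], ![1, 1, 2], ![1, 1, 1], ![1, 2, 0], ![1, 1, 0], ![1, 0, 0], ![0, 0, 0]] :
      Fin 7 → Fin 3 → ℕ) i)

/-- The last slice of `T` is in the `i`-th configuration. -/
def EndsIn {n : ℕ} (i : Fin 7) (T : ColoredPartition (starPath (n + 1)) 2) : Prop :=
  (∀ v, T.color (v, Fin.last n) = sliceColor i v) ∧
  ∀ u v, T.blocks (u, Fin.last n) (v, Fin.last n) ↔ sliceLabel i u = sliceLabel i v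

open scoped Classical in
/-- The generating function `T_{i+1}(x, y)` of the 2-colored partitions of `K_{1,3} × P_n`, `n ≥ 1`,
whose last slice is in the `i`-th configuration. -/
noncomputable def sliceGF (i : Fin 7) : Coeffs⟦X⟧ :=
  PowerSeries.mk fun n => match n with
    | 0 => 0
    | n + 1 => ∑ T : ColoredPartition (starPath (n + 1)) 2 with EndsIn i T, yVar ^ T.size

/-- The transfer matrix `𝓡`, with the entries depending on `y`. -/
noncomputable def transferMatrix (y : Coeffs) : Matrix (Fin 7) (Fin 7) Coeffs :=
  !![y^4 + 1, 3*y^4, y^4, 3*y^3 + 3*y, 3*y^3, 3*y^2, y^3;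
     0, 1, 0, 0, y, y^2, 0;
     0, 0, 1, 0, 0, 0, y;
     y^2 + 1, 3*y^2 + 2, y^2, y^3 + 4*y + 1, y^3 + 4*y, 3*y^2 + 2*y, y^2;
     0, 1, 1, 0, 1, 1, y;
     2, y + 5, y + 1, (3*y^2 + 2*y + 1) / y, 3*y + 3, y^2 + 2*y + 3, 2*y;
     (y^2 + 1) / y^2, (3*y + 3) / y, 2, (3*y + 3) / y, 6, 6, y + 1]

/-- The vector `b / x`, where `b` is the vector of base cases (`n = 1`). -/
noncomputable def baseVector (y : Coeffs) : Fin 7 → Coeffs :=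
  ![y^4, 0, 0, y^3, 0, y^2, y]

open Polynomial in
/-- The numerator `p(x, y)`, as a polynomial in `x = X`. -/
noncomputable def starNum (y : Coeffs) : Polynomial Coeffs :=
  C (2*y^4 + 6*y^3 + 6*y^2 + 2*y) * X +
  C (-8*y^7 + 4*y^6 - 28*y^5 + 40*y^4 - 44*y^3 + 4*y^2 - 16*y) * X^2 +
  C (14*y^9 - 22*y^8 - 4*y^7 + 104*y^6 - 106*y^5 - 32*y^4 + 90*y^3 - 52*y^2 + 40*y) * X^3 +
  C (-8*y^10 - 8*y^9 + 124*y^8 - 204*y^7 + 52*y^6 + 64*y^5 + 16*y^4 - 80*y^3 + 92*y^2 - 48*y) *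
    X^4 +
  C (-10*y^11 + 4*y^10 + 110*y^9 - 268*y^8 + 112*y^7 + 384*y^6 - 662*y^5 + 468*y^4 - 120*y^3 -
    48*y^2 + 30*y) * X^5 +
  C (16*y^11 - 28*y^10 - 156*y^9 + 656*y^8 - 1028*y^7 + 708*y^6 - 316*y^4 + 168*y^3 - 12*y^2 -
    8*y) * X^6 +
  C (8*y^11 - 58*y^10 + 228*y^9 - 562*y^8 + 852*y^7 - 756*y^6 + 340*y^5 - 26*y^4 - 36*y^3 +
    10*y^2) * X^7

open Polynomial in
/-- The denominator `q(x, y)`, as a polynomial in `x = X`. -/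
noncomputable def starDen (y : Coeffs) : Polynomial Coeffs :=
  1 +
  C (-y^4 - y^3 - y^2 - 7*y - 9) * X +
  C (y^7 + y^6 + 5*y^5 + 11*y^4 - 4*y^3 - 6*y^2 + 14*y + 28) * X^2 +
  C (-y^9 - 3*y^8 + y^7 + 5*y^6 - 22*y^5 - 11*y^4 + 7*y^3 + 54*y^2 - 18*y - 44) * X^3 +
  C (7*y^9 - 17*y^8 + 2*y^7 + 20*y^6 - 32*y^5 + 45*y^4 + 42*y^3 - 105*y^2 - y + 39) * X^4 +
  C (y^11 + 4*y^10 - 24*y^9 + 47*y^8 - 28*y^7 - 62*y^6 + 167*y^5 - 125*y^4 - 50*y^3 + 83*y^2 +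
    6*y - 19) * X^5 +
  C (y^11 - 24*y^10 + 94*y^9 - 122*y^8 - 61*y^7 + 365*y^6 - 409*y^5 + 116*y^4 + 116*y^3 -
    91*y^2 + 11*y + 4) * X^6 +
  C (-3*y^11 + 23*y^10 - 74*y^9 + 95*y^8 + 45*y^7 - 289*y^6 + 355*y^5 - 183*y^4 + 18*y^3 +
    18*y^2 - 5*y) * X^7

/-! ### Two ways to see a colored partition -/

namespace ColoredPartition

variable {V : Type*} {G : SimpleGraph V} {k : ℕ}

/-! A colored partition is determined by its coloring: the blocks are the components of the graph
formed by the edges with ends of equal color (`blocks_le_iff`, `colorEquiv`). So `T` is a sum over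
all 2-colorings, weighted by `y` to the number of monochromatic components, and a transfer matrix
applies.

Add a slice to a partition by first counting its four vertices as new blocks, then merging along the
new monochromatic edges one at a time. Each merge of two different blocks lowers the number of
blocks by one, so `m` effective merges contribute the factor `y^(4-m)`. Both `m` and the pattern on
the new slice depend only on the colors of the new slice and on the state of the slice before it:
its colors and its pattern of blocks (`IsLabelling.exists_mergeLabels`, `hasState_step`). Only
finitely many transitions remain, and these are computed (`filterMap_transition_perm`).

A slice has thirty states: two colors of the center times the fifteen set partitions of four
vertices. Up to permuting leaves and swapping colors they form seven configurations. The multiset of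
transitions into a state depends only on its configuration, so by induction the sums do too
(`stateSum_eq`), which gives the 7×7 system. The rational form then follows by linear elimination
(`transfer_elimination`). -/

theorem color_eq_of_blocks (P : ColoredPartition G k) {x y : V} (h : P.blocks x y) :
    P.color x = P.color y :=
  P.monochromatic _ (P.blocks.mem_classes y) x h y (P.blocks.refl y)

theorem blocks_of_adj (P : ColoredPartition G k) {x y : V} (h : G.Adj x y)
    (hc : P.color x = P.color y) : P.blocks x y := by
  by_contra hxy
  refine P.neighbors _ (P.blocks.mem_classes x) _ (P.blocks.mem_classes y) (fun he => hxy ?_)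
    ⟨x, P.blocks.refl x, y, P.blocks.refl y, h⟩ x (P.blocks.refl x) y (P.blocks.refl y) hc
  have : x ∈ {z | P.blocks z y} := he ▸ P.blocks.refl x
  exact this

/-- The blocks are the classes of the least equivalence relation which identifies adjacent
vertices of the same color. -/
theorem blocks_le_iff (P : ColoredPartition G k) (s : Setoid V) :
    (∀ x y, G.Adj x y ∧ P.color x = P.color y → s x y) ↔ P.blocks ≤ s := by
  refine ⟨fun h x y hxy => ?_, fun h x y hxy => h (P.blocks_of_adj hxy.1 hxy.2)⟩
  have hB := P.blocks.mem_classes y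
  obtain ⟨w⟩ := (P.connected _ hB).preconnected ⟨x, hxy⟩ ⟨y, P.blocks.refl y⟩
  have key : ∀ (a b : {z | P.blocks z y}), (G.induce {z | P.blocks z y}).Walk a b →
      s a.1 b.1 := by
    intro a b w
    induction w with
    | nil => exact s.refl _
    | @cons a b c hab _ ih =>
      refine s.trans (h _ _ ⟨by simpa using hab, ?_⟩) ih
      exact P.monochromatic _ hB _ a.2 _ b.2
  exact key _ _ w

variable (G) in
/-- The graph whose edges are the edges of `G` with ends of the same color. -/
def monoGraph (c : V → Fin k) : SimpleGraph V where
  Adj x y := G.Adj x y ∧ c x = c y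
  symm := ⟨fun _ _ h => ⟨h.1.symm, h.2.symm⟩⟩
  loopless := ⟨fun _ h => h.1.ne rfl⟩

theorem color_eq_of_reachable {c : V → Fin k} {x y : V} (h : (monoGraph G c).Reachable x y) :
    c x = c y := by
  obtain ⟨w⟩ := h
  induction w with
  | nil => rfl
  | cons h _ ih => exact h.2.trans ih

variable (G) in
/-- The colored partition with a given coloring. -/
def ofColor [Nonempty V] (c : V → Fin k) : ColoredPartition G k where
  blocks := (monoGraph G c).reachableSetoid
  color := c
  nonempty := ⟨_, Setoid.mem_classes _ (Classical.arbitrary V)⟩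
  connected := by
    rintro B ⟨y, rfl⟩
    have hle : (monoGraph G c).induce {z | (monoGraph G c).reachableSetoid z y} ≤
        G.induce {z | (monoGraph G c).reachableSetoid z y} := fun a b h => h.1
    refine SimpleGraph.Connected.mono hle ?_
    have hset : {z | (monoGraph G c).reachableSetoid z y} =
        ((monoGraph G c).connectedComponentMk y).supp := by
      ext z
      exact SimpleGraph.ConnectedComponent.eq.symm
    rw [hset]
    exact ((monoGraph G c).connectedComponentMk y).connected_toSimpleGraph
  monochromatic := by
    rintro B ⟨y, rfl⟩ u hu v hv
    exact color_eq_of_reachable (SimpleGraph.Reachable.trans hu (SimpleGraph.Reachable.symm hv))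
  neighbors := by
    rintro B ⟨x, rfl⟩ C ⟨y, rfl⟩ hne ⟨u, hu, v, hv, huv⟩ u' hu' v' hv' hc
    apply hne
    have h1 : c u' = c u :=
      color_eq_of_reachable (SimpleGraph.Reachable.trans hu' (SimpleGraph.Reachable.symm hu))
    have h2 : c v' = c v :=
      color_eq_of_reachable (SimpleGraph.Reachable.trans hv' (SimpleGraph.Reachable.symm hv))
    have h3 : (monoGraph G c).Adj u v := ⟨huv, by rw [← h1, ← h2, hc]⟩
    have h4 : (monoGraph G c).Reachable x y :=
      (SimpleGraph.Reachable.symm hu).trans (h3.reachable.trans hv)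
    ext z
    exact ⟨fun h => SimpleGraph.Reachable.trans h h4,
      fun h => SimpleGraph.Reachable.trans h h4.symm⟩

/-- Both block relations are least for the same set of monochromatic edges, so each is contained in
the other. -/
theorem ext_color {P Q : ColoredPartition G k} (h : P.color = Q.color) : P = Q := by
  refine ColoredPartition.ext (le_antisymm ?_ ?_) h
  · rw [← P.blocks_le_iff, h, Q.blocks_le_iff]
  · rw [← Q.blocks_le_iff, ← h, P.blocks_le_iff]

/-- Colored partitions of a nonempty graph correspond to colorings of the vertices. -/
def colorEquiv [Nonempty V] : ColoredPartition G k ≃ (V → Fin k) where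
  toFun P := P.color
  invFun := ofColor G
  left_inv _ := ext_color rfl
  right_inv _ := rfl

end ColoredPartition

/-! ### Labellings -/

/-- Two vertices have the same label under `f` if and only if they are related by the equivalence
relation generated by `E`. -/
def IsLabelling {V L : Type*} (E : V → V → Prop) (f : V → L) : Prop :=
  ∀ s : Setoid V, (∀ x y, E x y → s x y) ↔ Setoid.ker f ≤ s

namespace ColoredPartition

variable {V L : Type*} {G : SimpleGraph V} {k : ℕ}

theorem blocks_eq_ker (P : ColoredPartition G k) {f : V → L}
    (hf : IsLabelling (fun x y => G.Adj x y ∧ P.color x = P.color y) f) :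
    P.blocks = Setoid.ker f :=
  le_antisymm ((P.blocks_le_iff _).1 ((hf _).2 le_rfl)) ((hf _).1 ((P.blocks_le_iff _).2 le_rfl))

/-- The blocks are the nonempty fibres of `f`, one for each label in use. -/
theorem size_eq_ncard_range (P : ColoredPartition G k) {f : V → L}
    (hf : P.blocks = Setoid.ker f) : P.size = (Set.range f).ncard := by
  rw [size, hf]
  have : (Setoid.ker f).classes = (fun l => f ⁻¹' {l}) '' Set.range f := by
    ext B
    simp only [Setoid.classes, Set.mem_ofPred_eq, Set.mem_image, Set.mem_range,
      exists_exists_eq_and]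
    exact exists_congr fun a => eq_comm
  rw [this, Set.InjOn.ncard_image]
  rintro _ ⟨a, rfl⟩ l _ h
  exact (Set.ext_iff.1 h a).1 rfl

end ColoredPartition

section Merge

variable {V L W : Type*} [DecidableEq L]

/-- Replace the label of `u` by the label of `v` wherever it occurs. -/
def mergeLabel (f : V → L) (u v : V) : V → L := fun x => if f x = f u then f v else f x

/-- One union step: adding the generator `(u, v)` joins the class of `u` to that of `v` and changes
nothing else. The cases below ask which of the two points carried the label that was replaced. -/
theorem IsLabelling.mergeLabel {E : V → V → Prop} {f : V → L} (hf : IsLabelling E f) (u v : V) :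
    IsLabelling (fun x y => E x y ∨ x = u ∧ y = v) (mergeLabel f u v) := by
  intro s
  constructor
  · intro h x y hxy
    have hle : Setoid.ker f ≤ s := (hf s).1 fun x y hE => h x y (Or.inl hE)
    have huv : s u v := h u v (Or.inr ⟨rfl, rfl⟩)
    have hf' : ∀ {a b}, f a = f b → s a b := fun {a b} hab => hle hab
    replace hxy : (if f x = f u then f v else f x) = if f y = f u then f v else f y := hxy
    split_ifs at hxy with h1 h2 h2
    · exact hf' (h1.trans h2.symm)
    · exact s.trans (s.trans (hf' h1) huv) (hf' hxy)
    · exact s.trans (hf' hxy) (s.trans (s.symm huv) (hf' h2.symm))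
    · exact hf' hxy
  · rintro h x y (hE | ⟨rfl, rfl⟩)
    · refine h (?_ : _ = _)
      have : f x = f y := (hf (Setoid.ker f)).2 le_rfl x y hE
      simp [_root_.mergeLabel, this]
    · refine h (?_ : _ = _)
      simp [_root_.mergeLabel]

/-- If the labels of `u` and `v` differ, exactly the label of `u` disappears; otherwise nothing
changes. -/
theorem ncard_range_mergeLabel [Finite V] (f : V → L) (u v : V) :
    (Set.range (mergeLabel f u v)).ncard + (if f u = f v then 0 else 1) = (Set.range f).ncard := by
  split_ifs with h
  · have : mergeLabel f u v = f := by
      funext x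
      by_cases hx : f x = f u <;> simp [mergeLabel, hx, ← h]
    rw [this, add_zero]
  · have : Set.range (mergeLabel f u v) = Set.range f \ {f u} := by
      ext l
      simp only [Set.mem_range, mergeLabel, Set.mem_sdiff, Set.mem_singleton_iff]
      constructor
      · rintro ⟨x, rfl⟩
        split_ifs with hx
        · exact ⟨⟨v, rfl⟩, fun hv => h hv.symm⟩
        · exact ⟨⟨x, rfl⟩, hx⟩
      · rintro ⟨⟨x, rfl⟩, hx⟩
        exact ⟨x, if_neg hx⟩
    rw [this]
    exact Set.ncard_sdiff_singleton_add_one ⟨u, rfl⟩ (Set.finite_range f)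

/-- The labels after merging along a list of edges. -/
def mergeLabels : List (W × W) → (W → L) → W → L
  | [], g => g
  | e :: es, g => mergeLabels es (mergeLabel g e.1 e.2)

/-- The number of merging steps in which the two labels are different. -/
def mergeCount : List (W × W) → (W → L) → ℕ
  | [], _ => 0
  | e :: es, g => (if g e.1 = g e.2 then 0 else 1) + mergeCount es (mergeLabel g e.1 e.2)

/-- The reduction to a finite computation. Merges along edges between points `ι a` only compare
labels of such points, so a labelling `g` of `W` with the same pattern of equalities predicts which
merges are effective and what pattern results, whatever the rest of `V` looks like. -/
theorem IsLabelling.exists_mergeLabels {M : Type*} [DecidableEq M] [Finite V] (ι : W → V)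
    (es : List (W × W)) :
    ∀ {E : V → V → Prop} {f : V → L} {g : W → M}, IsLabelling E f →
      (∀ a b, f (ι a) = f (ι b) ↔ g a = g b) →
      ∃ f' : V → L, IsLabelling (fun x y => E x y ∨ ∃ e ∈ es, x = ι e.1 ∧ y = ι e.2) f' ∧
        (∀ a b, f' (ι a) = f' (ι b) ↔ mergeLabels es g a = mergeLabels es g b) ∧
        (Set.range f').ncard + mergeCount es g = (Set.range f).ncard := by
  induction es with
  | nil =>
    intro E f g hf hfg
    exact ⟨f, by simpa using hf, hfg, rfl⟩
  | cons e es ih =>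
    intro E f g hf hfg
    have hfg' : ∀ a b, _root_.mergeLabel f (ι e.1) (ι e.2) (ι a) =
        _root_.mergeLabel f (ι e.1) (ι e.2) (ι b) ↔
        _root_.mergeLabel g e.1 e.2 a = _root_.mergeLabel g e.1 e.2 b := by
      intro a b
      simp only [_root_.mergeLabel, hfg]
      split_ifs <;> simp [hfg]
    obtain ⟨f', h1, h2, h3⟩ := ih (hf.mergeLabel (ι e.1) (ι e.2)) hfg'
    refine ⟨f', ?_, h2, ?_⟩
    · simpa [or_assoc] using h1
    · have := ncard_range_mergeLabel f (ι e.1) (ι e.2)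
      simp only [hfg] at this
      rw [← this, ← h3, mergeCount]
      omega

end Merge

/-! ### States of a slice -/

/-- The vertices of a slice. -/
abbrev StarVertex : Type := Fin 1 ⊕ Fin 3

/-- A state of a slice: the color of the center and the labels of the leaves. The center has
label `0`, and the vertices with label `0` are those with the color of the center. -/
abbrev SliceState : Type := Fin 2 × (Fin 3 → ℕ)

/-- The labels of the vertices of a slice in a given state. -/
def SliceState.label (σ : SliceState) : StarVertex → ℕ := Sum.elim (fun _ => 0) σ.2

/-- The colors of the vertices of a slice in a given state. -/
def SliceState.color (σ : SliceState) (v : StarVertex) : Fin 2 :=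
  if σ.label v = 0 then σ.1 else σ.1 + 1

/-- The labels of the leaves in the states that agree with the `i`-th configuration up to a
permutation of the leaves. -/
def leafLabels : Fin 7 → List (Fin 3 → ℕ) :=
  ![[![1, 2, 3]],
    [![1, 1, 2], ![1, 2, 1], ![2, 1, 1]],
    [![1, 1, 1]],
    [![1, 2, 0], ![1, 0, 2], ![0, 1, 2]],
    [![1, 1, 0], ![1, 0, 1], ![0, 1, 1]],
    [![1, 0, 0], ![0, 1, 0], ![0, 0, 1]],
    [![0, 0, 0]]]

/-- The states that agree with the `i`-th configuration up to symmetry. -/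
def sliceStates (i : Fin 7) : List SliceState :=
  (leafLabels i).map (fun w => (0, w)) ++ (leafLabels i).map (fun w => (1, w))

/-- The `i`-th configuration. -/
def sliceState (i : Fin 7) : SliceState := (0, fun l => sliceLabel i (Sum.inr l))

theorem label_sliceState : ∀ i v, (sliceState i).label v = sliceLabel i v := by decide

theorem color_sliceState : ∀ i v, (sliceState i).color v = sliceColor i v := by decide

theorem sliceState_mem : ∀ i, sliceState i ∈ sliceStates i := by decide

/-- The edges of `K_{1,3}`. -/
def starEdges : List (StarVertex × StarVertex) :=
  [(.inl 0, .inr 0), (.inl 0, .inr 1), (.inl 0, .inr 2)]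

/-- The edges which the last slice adds to the graph; `Sum.inl` stands for the slice before it. -/
def stepEdges : List ((StarVertex ⊕ StarVertex) × (StarVertex ⊕ StarVertex)) :=
  starEdges.map (Prod.map Sum.inr Sum.inr) ++
    [.inl 0, .inr 0, .inr 1, .inr 2].map fun v : StarVertex => (.inl v, .inr v)

theorem star_adj_iff {u v : StarVertex} :
    star.Adj u v ↔ (u, v) ∈ starEdges ∨ (v, u) ∈ starEdges := by
  obtain u | u := u <;> obtain v | v := v <;> fin_cases u <;> fin_cases v <;> simp [starEdges]

theorem mem_stepEdges {e : (StarVertex ⊕ StarVertex) × (StarVertex ⊕ StarVertex)} :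
    e ∈ stepEdges ↔
      (∃ u v, (u, v) ∈ starEdges ∧ e = (.inr u, .inr v)) ∨ ∃ v, e = (.inl v, .inr v) := by
  have h : ∀ v : StarVertex, v ∈ [(.inl 0 : StarVertex), .inr 0, .inr 1, .inr 2] := by
    rintro (v | v) <;> fin_cases v <;> simp
  simp only [stepEdges, List.mem_append, List.mem_map, Prod.exists, Prod.map]
  refine or_congr ?_ ?_
  · exact exists_congr fun u => exists_congr fun v => and_congr_right fun _ => eq_comm
  · exact exists_congr fun v => ⟨fun hv => hv.2.symm, fun hv => ⟨h v, hv.symm⟩⟩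

/-- Labels of the vertices of a new slice, different from the labels of a state. -/
def freshLabel : StarVertex → ℕ := Sum.elim (fun _ => 4) ![5, 6, 7]

theorem freshLabel_inj : ∀ u v, freshLabel u = freshLabel v ↔ u = v := by decide

theorem label_ne_freshLabel : ∀ i, ∀ σ ∈ sliceStates i, ∀ u v, σ.label u ≠ freshLabel v := by
  decide +kernel

/-- The edges with ends of the same color. -/
def monoEdges {W : Type*} (c : W → Fin 2) (es : List (W × W)) : List (W × W) :=
  es.filter fun e => c e.1 = c e.2

theorem mem_monoEdges {W : Type*} {c : W → Fin 2} {es : List (W × W)} {e : W × W} :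
    e ∈ monoEdges c es ↔ e ∈ es ∧ c e.1 = c e.2 := by
  simp [monoEdges]

/-- Two labellings of a slice define the same partition. -/
def SamePattern (f g : StarVertex → ℕ) : Prop := ∀ u v, f u = f v ↔ g u = g v

instance (f g : StarVertex → ℕ) : Decidable (SamePattern f g) := by
  unfold SamePattern; infer_instance

/-- If a slice in state `σ` can be followed by one in state `τ`, the number of blocks that are
merged with others when the latter is added, its four vertices being counted as blocks. -/
def transition (τ σ : SliceState) : Option ℕ :=
  let es := monoEdges (Sum.elim σ.color τ.color) stepEdges
  let g : StarVertex ⊕ StarVertex → ℕ := Sum.elim σ.label freshLabel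
  if SamePattern (fun v => mergeLabels es g (.inr v)) τ.label then some (mergeCount es g) else none

/-- The analogue of `transition` for the first slice. -/
def initial (τ : SliceState) : Option ℕ :=
  let es := monoEdges τ.color starEdges
  if SamePattern (mergeLabels es freshLabel) τ.label then some (mergeCount es freshLabel) else none

/-- The values of `transition` by configurations. -/
def transitionTable : Fin 7 → Fin 7 → List ℕ :=
  ![![[0, 4], [0, 0, 0], [0], [1, 1, 1, 3, 3, 3], [1, 1, 1], [2, 2, 2], [1]],
    ![[], [4], [], [], [3], [2], []],
    ![[], [], [4], [], [], [], [3]],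
    ![[2, 4], [2, 2, 2, 4, 4], [2], [1, 3, 3, 3, 3, 4], [1, 3, 3, 3, 3], [2, 2, 2, 3, 3], [2]],
    ![[], [4], [4], [], [4], [4], [3]],
    ![[4, 4], [3, 4, 4, 4, 4, 4], [3, 4], [3, 3, 3, 4, 4, 5], [3, 3, 3, 4, 4, 4],
      [2, 3, 3, 4, 4, 4], [3, 3]],
    ![[4, 6], [4, 4, 4, 5, 5, 5], [4, 4], [4, 4, 4, 5, 5, 5], [4, 4, 4, 4, 4, 4],
      [4, 4, 4, 4, 4, 4], [3, 4]]]

/-- Impossible transitions are dropped, and lists are compared up to order. Since `τ` runs over all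
states of a configuration, the check also shows that the row does not depend on the representative;
this replaces an argument by symmetry of the graph. -/
theorem filterMap_transition_perm : ∀ j, ∀ τ ∈ sliceStates j, ∀ i,
    ((sliceStates i).filterMap (transition τ)).Perm (transitionTable j i) := by
  decide +kernel

/-- In a single slice, leaves of the color opposite to the center are isolated, so configurations
joining two of them cannot occur. Every leaf of the center's color accounts for one merge. -/
theorem initial_eq : ∀ j, ∀ τ ∈ sliceStates j,
    initial τ = ![some 0, none, none, some 1, none, some 2, some 3] j := by
  decide +kernel

/-- The listed states represent every set partition of the four vertices exactly once for each color
of the center. Four labels suffice for all patterns. -/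
theorem sum_countP_samePattern : ∀ (a : Fin 2) (g : Fin 3 → Fin 4),
    ∑ i, (sliceStates i).countP (fun σ =>
      σ.1 = a ∧ SamePattern σ.label (Sum.elim (fun _ => 0) fun l => (g l : ℕ))) = 1 := by
  decide +kernel

/-! ### Adding a slice -/

/-- Since a `Setoid` is symmetric, listing each edge in one direction is enough. -/
theorem IsLabelling.congr {V L : Type*} {E E' : V → V → Prop} {f : V → L} (hf : IsLabelling E f)
    (h : ∀ x y, E x y → E' x y) (h' : ∀ x y, E' x y → E x y ∨ E y x) : IsLabelling E' f := by
  intro s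
  rw [← hf s]
  refine ⟨fun hs x y hxy => hs x y (h x y hxy), fun hs x y hxy => ?_⟩
  exact (h' x y hxy).elim (hs x y) fun h => s.symm (hs y x h)

theorem starPath_adj_iff {n : ℕ} {u v : StarVertex} {i j : Fin n} :
    (starPath n).Adj (u, i) (v, j) ↔
      star.Adj u v ∧ i = j ∨ (i.val + 1 = j.val ∨ j.val + 1 = i.val) ∧ u = v := by
  rw [SimpleGraph.boxProd_adj, SimpleGraph.pathGraph_adj]

namespace ColoredPartition

/-- The last slice is in a given state. -/
def HasState {n : ℕ} (P : ColoredPartition (starPath (n + 1)) 2) (σ : SliceState) : Prop :=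
  (∀ v, P.color (v, Fin.last n) = σ.color v) ∧
  ∀ u v, P.blocks (u, Fin.last n) (v, Fin.last n) ↔ σ.label u = σ.label v

theorem hasState_sliceState_iff {n : ℕ} {P : ColoredPartition (starPath (n + 1)) 2} {i : Fin 7} :
    P.HasState (sliceState i) ↔ EndsIn i P := by
  simp only [HasState, EndsIn, label_sliceState, color_sliceState]

variable {n : ℕ}

/-- A slice vertex, or one of the slice before. -/
def lastTwo (n : ℕ) : StarVertex ⊕ StarVertex → StarVertex × Fin (n + 2) :=
  Sum.elim (fun v => (v, (Fin.last n).castSucc)) fun v => (v, Fin.last (n + 1))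

/-- The labelling of the vertices by their blocks, before the last slice is connected. -/
def addSlice (P : ColoredPartition (starPath (n + 1)) 2) (x : StarVertex × Fin (n + 2)) :
    Quotient P.blocks ⊕ StarVertex :=
  Fin.lastCases (motive := fun _ => Quotient P.blocks ⊕ StarVertex) (Sum.inr x.1)
    (fun i => Sum.inl (Quotient.mk _ (x.1, i))) x.2

variable (P : ColoredPartition (starPath (n + 1)) 2)

@[simp] theorem addSlice_last (v : StarVertex) :
    P.addSlice (v, Fin.last (n + 1)) = Sum.inr v := by
  simp [addSlice]

@[simp] theorem addSlice_castSucc (v : StarVertex) (i : Fin (n + 1)) :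
    P.addSlice (v, i.castSucc) = Sum.inl (Quotient.mk _ (v, i)) := by
  simp [addSlice]

theorem isLabelling_addSlice :
    IsLabelling (fun x y => ∃ u v i j, x = (u, Fin.castSucc i) ∧ y = (v, Fin.castSucc j) ∧
      (starPath (n + 1)).Adj (u, i) (v, j) ∧ P.color (u, i) = P.color (v, j)) P.addSlice := by
  intro s
  let ι : StarVertex × Fin (n + 1) → StarVertex × Fin (n + 2) := fun x => (x.1, x.2.castSucc)
  have h1 := P.blocks_le_iff (s.comap ι)
  constructor
  · intro h
    have h2 : P.blocks ≤ s.comap ι :=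
      h1.1 fun x y hxy => h _ _ ⟨x.1, y.1, x.2, y.2, rfl, rfl, hxy⟩
    rintro ⟨u, i⟩ ⟨v, j⟩ hxy
    replace hxy : P.addSlice (u, i) = P.addSlice (v, j) := hxy
    induction i using Fin.lastCases with
    | last =>
      induction j using Fin.lastCases with
      | last =>
        obtain rfl : u = v := by simpa using hxy
        exact s.refl _
      | cast j => simp at hxy
    | cast i =>
      induction j using Fin.lastCases with
      | last => simp at hxy
      | cast j =>
        have : P.blocks (u, i) (v, j) := by simpa [Quotient.eq] using hxy
        exact h2 this
  · rintro h _ _ ⟨u, v, i, j, rfl, rfl, hadj, hc⟩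
    refine h (?_ : _ = _)
    have : P.blocks (u, i) (v, j) := P.blocks_of_adj hadj hc
    simpa [Quotient.eq] using this

theorem ncard_range_addSlice : (Set.range P.addSlice).ncard = P.size + 4 := by
  have h1 : Set.range P.addSlice = Set.univ := by
    rw [Set.range_eq_univ]
    rintro (q | v)
    · obtain ⟨⟨v, i⟩, rfl⟩ := Quotient.exists_rep q
      exact ⟨(v, i.castSucc), by simp⟩
    · exact ⟨(v, Fin.last _), by simp⟩
  have h2 := P.size_eq_ncard_range (f := Quotient.mk P.blocks) (Setoid.ker_mk_eq _).symm
  rw [Set.range_eq_univ.2 Quotient.mk_surjective, Set.ncard_univ] at h2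
  rw [h1, h2, Set.ncard_univ, Nat.card_sum]
  simp

variable {P} {Q : ColoredPartition (starPath (n + 2)) 2} {σ τ : SliceState} {k : Fin 7}

/-- An edge of the longer product lies in the old part, inside the last slice, or between the last
two slices; the latter two kinds are those in `stepEdges`. -/
theorem isLabelling_step (hPQ : ∀ v i, Q.color (v, Fin.castSucc i) = P.color (v, i))
    {c : StarVertex ⊕ StarVertex → Fin 2} (hc : ∀ a, Q.color (lastTwo n a) = c a)
    {L : Type*} {f : StarVertex × Fin (n + 2) → L}
    (hf : IsLabelling (fun x y =>
      (∃ u v i j, x = (u, Fin.castSucc i) ∧ y = (v, Fin.castSucc j) ∧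
        (starPath (n + 1)).Adj (u, i) (v, j) ∧ P.color (u, i) = P.color (v, j)) ∨
      ∃ e ∈ monoEdges c stepEdges, x = lastTwo n e.1 ∧ y = lastTwo n e.2) f) :
    IsLabelling (fun x y => (starPath (n + 2)).Adj x y ∧ Q.color x = Q.color y) f := by
  refine hf.congr ?_ ?_
  · rintro _ _ (⟨u, v, i, j, rfl, rfl, hadj, hcol⟩ | ⟨e, he, rfl, rfl⟩)
    · refine ⟨?_, by rw [hPQ, hPQ, hcol]⟩
      rw [starPath_adj_iff] at hadj ⊢
      simpa using hadj
    · rw [mem_monoEdges, mem_stepEdges] at he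
      refine ⟨?_, by rw [hc, hc, he.2]⟩
      obtain ⟨u, v, huv, rfl⟩ | ⟨v, rfl⟩ := he.1
      · exact starPath_adj_iff.2 (Or.inl ⟨star_adj_iff.2 (Or.inl huv), rfl⟩)
      · exact starPath_adj_iff.2 (Or.inr ⟨Or.inl (by simp), rfl⟩)
  · have hvert : ∀ {u v : StarVertex} {i : Fin (n + 1)},
        (starPath (n + 2)).Adj (u, i.castSucc) (v, Fin.last (n + 1)) →
        Q.color (u, i.castSucc) = Q.color (v, Fin.last (n + 1)) →
        ∃ e ∈ monoEdges c stepEdges, (u, i.castSucc) = lastTwo n e.1 ∧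
          (v, Fin.last (n + 1)) = lastTwo n e.2 := by
      intro u v i hadj hcol
      rw [starPath_adj_iff] at hadj
      obtain ⟨_, h⟩ | ⟨h, rfl⟩ := hadj
      · exact absurd h (Fin.castSucc_lt_last i).ne
      · obtain rfl : i = Fin.last n := by
          ext
          have := i.isLt
          simp only [Fin.val_castSucc, Fin.val_last] at h ⊢
          omega
        refine ⟨(.inl u, .inr u), mem_monoEdges.2 ⟨mem_stepEdges.2 (Or.inr ⟨u, rfl⟩), ?_⟩, rfl, rfl⟩
        rw [← hc, ← hc]
        exact hcol
    rintro ⟨u, i⟩ ⟨v, j⟩ ⟨hadj, hcol⟩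
    induction i using Fin.lastCases with
    | last =>
      induction j using Fin.lastCases with
      | last =>
        have h : star.Adj u v := by
          rw [starPath_adj_iff] at hadj
          simpa using hadj
        have hcol' : c (.inr u) = c (.inr v) := by
          rw [← hc, ← hc]
          exact hcol
        refine (star_adj_iff.1 h).imp (fun he => Or.inr ?_) fun he => Or.inr ?_
        · exact ⟨(.inr u, .inr v),
            mem_monoEdges.2 ⟨mem_stepEdges.2 (Or.inl ⟨u, v, he, rfl⟩), hcol'⟩, rfl, rfl⟩
        · exact ⟨(.inr v, .inr u),
            mem_monoEdges.2 ⟨mem_stepEdges.2 (Or.inl ⟨v, u, he, rfl⟩), hcol'.symm⟩, rfl, rfl⟩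
      | cast j => exact Or.inr (Or.inr (hvert hadj.symm hcol.symm))
    | cast i =>
      induction j using Fin.lastCases with
      | last => exact Or.inl (Or.inr (hvert hadj hcol))
      | cast j =>
        refine Or.inl (Or.inl ⟨u, v, i, j, rfl, rfl, ?_, by rw [← hPQ, ← hPQ, hcol]⟩)
        rw [starPath_adj_iff] at hadj ⊢
        simpa using hadj

open scoped Classical in
-- The labelling `P.addSlice` has `P.size + 4` labels, and on the last two slices its pattern is
-- that of `σ` together with four fresh labels. Merging along the monochromatic edges of `stepEdges`
-- yields the blocks of `Q`.
theorem hasState_step (hPQ : ∀ v i, Q.color (v, Fin.castSucc i) = P.color (v, i))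
    (hσ : P.HasState σ) (hk : σ ∈ sliceStates k)
    (hτ : ∀ v, Q.color (v, Fin.last (n + 1)) = τ.color v) :
    if Q.HasState τ then ∃ m, transition τ σ = some m ∧ Q.size + m = P.size + 4
    else transition τ σ = none := by
  have hg : ∀ a b, P.addSlice (lastTwo n a) = P.addSlice (lastTwo n b) ↔
      (Sum.elim σ.label freshLabel : _ → ℕ) a = Sum.elim σ.label freshLabel b := by
    rintro (a | a) (b | b)
    · simpa [lastTwo, Quotient.eq] using hσ.2 a b
    · simpa [lastTwo] using label_ne_freshLabel k σ hk a b
    · simpa [lastTwo] using (label_ne_freshLabel k σ hk b a).symm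
    · simpa [lastTwo] using (freshLabel_inj a b).symm
  obtain ⟨f, hf, hfg, hcard⟩ := P.isLabelling_addSlice.exists_mergeLabels (lastTwo n)
    (monoEdges (Sum.elim σ.color τ.color) stepEdges) hg
  have hc : ∀ a, Q.color (lastTwo n a) = Sum.elim σ.color τ.color a := by
    rintro (a | a)
    · exact (hPQ _ _).trans (hσ.1 a)
    · exact hτ a
  have hker := Q.blocks_eq_ker (isLabelling_step hPQ hc hf)
  rw [P.ncard_range_addSlice, ← Q.size_eq_ncard_range hker] at hcard
  have hiff : Q.HasState τ ↔ SamePattern (fun v =>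
      mergeLabels (monoEdges (Sum.elim σ.color τ.color) stepEdges)
        (Sum.elim σ.label freshLabel) (.inr v)) τ.label := by
    have h : ∀ u v, Q.blocks (u, Fin.last (n + 1)) (v, Fin.last (n + 1)) ↔
        f (lastTwo n (.inr u)) = f (lastTwo n (.inr v)) := by
      intro u v
      rw [hker]
      rfl
    simp only [HasState, hτ, implies_true, true_and, SamePattern, h, hfg]
  split_ifs with h
  · exact ⟨_, if_pos (hiff.1 h), hcard⟩
  · exact if_neg (mt hiff.2 h)

open scoped Classical in
theorem hasState_initial {Q : ColoredPartition (starPath (0 + 1)) 2}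
    (hτ : ∀ v, Q.color (v, Fin.last 0) = τ.color v) :
    if Q.HasState τ then ∃ m, initial τ = some m ∧ Q.size + m = 4 else initial τ = none := by
  have hid : IsLabelling (fun _ _ => False) (id : StarVertex × Fin (0 + 1) → _) := by
    intro s
    refine ⟨fun _ x y hxy => ?_, by simp⟩
    obtain rfl : x = y := hxy
    exact s.refl _
  have hg : ∀ a b : StarVertex, id (a, Fin.last 0) = id (b, Fin.last 0) ↔
      freshLabel a = freshLabel b := by
    intro a b
    simp [freshLabel_inj]
  obtain ⟨f, hf, hfg, hcard⟩ := hid.exists_mergeLabels (fun v => (v, Fin.last 0))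
    (monoEdges τ.color starEdges) hg
  have hker := Q.blocks_eq_ker (f := f) (by
    refine hf.congr ?_ ?_
    · rintro _ _ (h | ⟨⟨u, v⟩, he, rfl, rfl⟩)
      · exact h.elim
      · rw [mem_monoEdges] at he
        exact ⟨starPath_adj_iff.2 (Or.inl ⟨star_adj_iff.2 (Or.inl he.1), rfl⟩),
          by rw [hτ, hτ]; exact he.2⟩
    · rintro ⟨u, i⟩ ⟨v, j⟩ ⟨hadj, hcol⟩
      obtain rfl : i = Fin.last 0 := Subsingleton.elim (α := Fin 1) _ _
      obtain rfl : j = Fin.last 0 := Subsingleton.elim (α := Fin 1) _ _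
      rw [hτ, hτ] at hcol
      have h : star.Adj u v := by
        rw [starPath_adj_iff] at hadj
        simpa using hadj
      refine (star_adj_iff.1 h).imp (fun he => Or.inr ?_) fun he => Or.inr ?_
      · exact ⟨(u, v), mem_monoEdges.2 ⟨he, hcol⟩, rfl, rfl⟩
      · exact ⟨(v, u), mem_monoEdges.2 ⟨he, hcol.symm⟩, rfl, rfl⟩)
  rw [← Q.size_eq_ncard_range hker, Set.range_id, Set.ncard_univ] at hcard
  have hiff : Q.HasState τ ↔ SamePattern
      (mergeLabels (monoEdges τ.color starEdges) freshLabel) τ.label := by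
    have h : ∀ u v, Q.blocks (u, Fin.last 0) (v, Fin.last 0) ↔
        f (u, Fin.last 0) = f (v, Fin.last 0) := by
      intro u v
      rw [hker]
      rfl
    simp only [HasState, hτ, implies_true, true_and, SamePattern, h, hfg]
  split_ifs with h
  · exact ⟨_, if_pos (hiff.1 h), by simpa using hcard⟩
  · exact if_neg (mt hiff.2 h)

/-- The state of a slice can be read off from the color of its center and a normalized labelling by
at most four labels, which brings it within reach of `sum_countP_samePattern`. -/
theorem exists_hasState_iff (P : ColoredPartition (starPath (n + 1)) 2) :
    ∃ (a : Fin 2) (g : Fin 3 → Fin 4), ∀ σ : SliceState, P.HasState σ ↔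
      σ.1 = a ∧ SamePattern σ.label (Sum.elim (fun _ => 0) fun l => (g l : ℕ)) := by
  let f : StarVertex → Quotient P.blocks := fun v => Quotient.mk _ (v, Fin.last n)
  have hf : ∀ {u v}, P.blocks (u, Fin.last n) (v, Fin.last n) ↔ f u = f v := by
    intro u v
    exact Quotient.eq.symm
  obtain ⟨e, he⟩ : ∃ e : Set.range f → Fin 4, Function.Injective e := by
    classical
    have h : Fintype.card (Set.range f) ≤ Fintype.card (Fin 4) :=
      (Fintype.card_range_le f).trans (by simp)
    obtain ⟨e⟩ := Function.Embedding.nonempty_of_card_le h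
    exact ⟨e, e.injective⟩
  -- The transposition renames the labels so that the block of the center gets label `0`.
  let e' : StarVertex → Fin 4 := fun v => Equiv.swap (e ⟨f (.inl 0), _, rfl⟩) 0 (e ⟨f v, _, rfl⟩)
  have hlab : ∀ v, (Sum.elim (fun _ => 0) fun l => (e' (.inr l) : ℕ)) v = (e' v : ℕ) := by
    rintro (v | v)
    · obtain rfl : v = 0 := Subsingleton.elim _ _
      simp [e']
    · rfl
  have hpat : ∀ u v, P.blocks (u, Fin.last n) (v, Fin.last n) ↔ (e' u : ℕ) = (e' v : ℕ) := by
    intro u v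
    rw [hf, Fin.val_inj, Equiv.apply_eq_iff_eq, he.eq_iff, Subtype.ext_iff]
  refine ⟨P.color (.inl 0, Fin.last n), fun l => e' (.inr l), fun σ => ?_⟩
  simp only [HasState, SamePattern, hlab, ← hpat]
  have hzero : σ.label (.inl 0) = 0 := rfl
  constructor
  · rintro ⟨h1, h2⟩
    refine ⟨?_, fun u v => (h2 u v).symm⟩
    rw [h1, SliceState.color, if_pos hzero]
  · rintro ⟨h1, h2⟩
    refine ⟨fun v => ?_, fun u v => (h2 u v).symm⟩
    rw [SliceState.color, ← hzero, h1]
    -- Every leaf is adjacent to the center, so it has the center's color exactly when it lies in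
    -- the center's block. With two colors, the pattern and the color of the center thus determine
    -- all the colors.
    have h3 : P.color (.inl 0, Fin.last n) = P.color (v, Fin.last n) ↔
        P.blocks (.inl 0, Fin.last n) (v, Fin.last n) := by
      refine ⟨fun h => ?_, P.color_eq_of_blocks⟩
      obtain v | v := v
      · obtain rfl : v = 0 := Subsingleton.elim _ _
        exact P.blocks.refl _
      · exact P.blocks_of_adj (starPath_adj_iff.2 (Or.inl ⟨by simp, rfl⟩)) h
    rw [← h2] at h3
    split_ifs with h4
    · exact (h3.2 h4.symm).symm
    · have h5 := mt h3.1 (Ne.symm h4)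
      revert h5
      generalize P.color (.inl 0, Fin.last n) = a
      generalize P.color (v, Fin.last n) = b
      revert a b
      decide

end ColoredPartition

/-! ### Sums over lists -/

theorem List.sum_map_ite_eq_countP {α R : Type*} [NonAssocSemiring R] (l : List α) (p : α → Prop)
    [DecidablePred p] (z : R) :
    (l.map fun a => if p a then z else 0).sum = (l.countP fun a => p a) * z := by
  induction l with
  | nil => simp
  | cons a l ih =>
    rw [List.map_cons, List.sum_cons, ih, List.countP_cons]
    by_cases h : p a <;> simp [h, add_mul, add_comm]

theorem Finset.sum_list_sum_map {ι α M : Type*} [AddCommMonoid M] (s : Finset ι) (l : List α)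
    (f : ι → α → M) : ∑ i ∈ s, (l.map (f i)).sum = (l.map fun a => ∑ i ∈ s, f i a).sum := by
  induction l with
  | nil => simp
  | cons a l ih => simp [Finset.sum_add_distrib, ih]

/-! ### The transfer matrix -/

theorem yVar_ne_zero : yVar ≠ 0 := RatFunc.X_ne_zero

/-- The factor by which a slice contributes to the weight `y ^ size`. -/
noncomputable def stepWeight (m : Option ℕ) : Coeffs :=
  m.elim 0 fun m => yVar ^ 4 / yVar ^ m

theorem sum_stepWeight {i j : Fin 7} {τ : SliceState} (hτ : τ ∈ sliceStates i) :
    ((sliceStates j).map fun σ => stepWeight (transition τ σ)).sum = transferMatrix yVar i j := by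
  have h1 : ∀ l : List SliceState, (l.map fun σ => stepWeight (transition τ σ)).sum =
      ((l.filterMap (transition τ)).map fun m => yVar ^ 4 / yVar ^ m).sum := by
    intro l
    induction l with
    | nil => simp
    | cons σ l ih =>
      rw [List.map_cons, List.sum_cons, ih, List.filterMap_cons]
      cases transition τ σ <;> simp [stepWeight]
  rw [h1, ((filterMap_transition_perm i τ hτ j).map _).sum_eq]
  have hy := yVar_ne_zero
  clear h1 hτ
  fin_cases i <;> fin_cases j <;>
    simp [transitionTable, transferMatrix, hy] <;> try field_simp
  all_goals ring

theorem stepWeight_initial {i : Fin 7} {τ : SliceState} (hτ : τ ∈ sliceStates i) :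
    stepWeight (initial τ) = baseVector yVar i := by
  rw [initial_eq i τ hτ]
  have hy := yVar_ne_zero
  clear hτ
  fin_cases i <;> simp [stepWeight, baseVector] <;> try field_simp

theorem pow_size_eq {a b m : ℕ} (h : a + m = b + 4) :
    yVar ^ a = stepWeight (some m) * yVar ^ b := by
  have hy := yVar_ne_zero
  simp only [stepWeight, Option.elim_some]
  rw [div_mul_eq_mul_div, eq_div_iff (pow_ne_zero _ hy), ← pow_add, ← pow_add, h, add_comm]

/-! ### Generating functions of the states -/

namespace ColoredPartition

/-- A coloring of `n + 2` slices is a coloring of `n + 1` slices and one of the last slice. -/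
def splitColoring (n : ℕ) : (StarVertex × Fin (n + 2) → Fin 2) ≃
    (StarVertex × Fin (n + 1) → Fin 2) × (StarVertex → Fin 2) where
  toFun c := (fun x => c (x.1, x.2.castSucc), fun v => c (v, Fin.last (n + 1)))
  invFun c x := Fin.lastCases (motive := fun _ => Fin 2) (c.2 x.1) (fun i => c.1 (x.1, i)) x.2
  left_inv c := by
    funext ⟨v, i⟩
    induction i using Fin.lastCases <;> simp
  right_inv c := by simp

/-- A colored partition of `n + 2` slices is given by its restriction to `n + 1` slices and the
colors of the last slice. -/
def splitEquiv (n : ℕ) : ColoredPartition (starPath (n + 2)) 2 ≃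
    ColoredPartition (starPath (n + 1)) 2 × (StarVertex → Fin 2) :=
  colorEquiv.trans ((splitColoring n).trans (colorEquiv.symm.prodCongr (Equiv.refl _)))

theorem color_splitEquiv_symm_castSucc {n : ℕ} (P : ColoredPartition (starPath (n + 1)) 2)
    (d : StarVertex → Fin 2) (v : StarVertex) (i : Fin (n + 1)) :
    ((splitEquiv n).symm (P, d)).color (v, i.castSucc) = P.color (v, i) := by
  obtain ⟨Q, hQ⟩ := (splitEquiv n).surjective (P, d)
  rw [← hQ, Equiv.symm_apply_apply, show P = (splitEquiv n Q).1 by rw [hQ]]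
  rfl

theorem color_splitEquiv_symm_last {n : ℕ} (P : ColoredPartition (starPath (n + 1)) 2)
    (d : StarVertex → Fin 2) (v : StarVertex) :
    ((splitEquiv n).symm (P, d)).color (v, Fin.last (n + 1)) = d v := by
  obtain ⟨Q, hQ⟩ := (splitEquiv n).surjective (P, d)
  rw [← hQ, Equiv.symm_apply_apply, show d = (splitEquiv n Q).2 by rw [hQ]]
  rfl

open scoped Classical in
-- The last slice is in exactly one of the listed states, so the indicators of the states sum to
-- one.
theorem sum_ite_hasState {n : ℕ} (P : ColoredPartition (starPath (n + 1)) 2) (z : Coeffs) :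
    ∑ i, ((sliceStates i).map fun σ => if P.HasState σ then z else 0).sum = z := by
  obtain ⟨a, g, h⟩ := P.exists_hasState_iff
  simp only [h, List.sum_map_ite_eq_countP]
  rw [← Finset.sum_mul, ← Nat.cast_sum]
  convert one_mul z
  convert Nat.cast_one
  convert sum_countP_samePattern a g

open scoped Classical in
/-- The sum of `y ^ size` over the colored partitions of `n + 1` slices with a given state of the
last slice. -/
noncomputable def stateSum (n : ℕ) (σ : SliceState) : Coeffs :=
  ∑ P : ColoredPartition (starPath (n + 1)) 2, if P.HasState σ then yVar ^ P.size else 0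

theorem sum_pow_size (n : ℕ) :
    ∑ P : ColoredPartition (starPath (n + 1)) 2, yVar ^ P.size =
      ∑ i, ((sliceStates i).map (stateSum n)).sum := by
  classical
  rw [← Finset.sum_congr rfl fun P _ => P.sum_ite_hasState (yVar ^ P.size), Finset.sum_comm]
  refine Finset.sum_congr rfl fun i _ => ?_
  rw [Finset.sum_list_sum_map]
  rfl

open scoped Classical in
theorem sum_step {n : ℕ} {P : ColoredPartition (starPath (n + 1)) 2} {i : Fin 7} {σ : SliceState}
    (hi : σ ∈ sliceStates i) (hσ : P.HasState σ) (τ : SliceState) :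
    (∑ d, if ((splitEquiv n).symm (P, d)).HasState τ then
        yVar ^ ((splitEquiv n).symm (P, d)).size else 0) =
      stepWeight (transition τ σ) * yVar ^ P.size := by
  -- State `τ` prescribes the colors of the new slice, so only one extension of `P` can contribute.
  rw [Finset.sum_eq_single τ.color]
  · have := hasState_step (color_splitEquiv_symm_castSucc P τ.color) hσ hi
      (color_splitEquiv_symm_last P τ.color)
    split_ifs at this ⊢ with h
    · obtain ⟨m, hm, hs⟩ := this
      rw [hm, pow_size_eq hs]
    · simp [this, stepWeight]
  · intro d _ hd
    refine if_neg fun h => hd (funext fun v => ?_)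
    rw [← color_splitEquiv_symm_last P d v, h.1]
  · simp

theorem stateSum_succ (n : ℕ) (τ : SliceState) :
    stateSum (n + 1) τ = ∑ i, ((sliceStates i).map fun σ =>
      stepWeight (transition τ σ) * stateSum n σ).sum := by
  classical
  rw [stateSum, ← (splitEquiv n).symm.sum_comp, Fintype.sum_prod_type]
  rw [← Finset.sum_congr rfl fun P _ => P.sum_ite_hasState _, Finset.sum_comm]
  refine Finset.sum_congr rfl fun i _ => ?_
  rw [Finset.sum_list_sum_map]
  refine congrArg List.sum (List.map_congr_left fun σ hσ => ?_)
  rw [stateSum, Finset.mul_sum]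
  refine Finset.sum_congr rfl fun P _ => ?_
  split_ifs with h
  · exact sum_step hσ h τ
  · simp

theorem stateSum_zero (τ : SliceState) : stateSum 0 τ = stepWeight (initial τ) := by
  classical
  let c : StarVertex × Fin (0 + 1) → Fin 2 := fun x => τ.color x.1
  rw [stateSum, Finset.sum_eq_single (colorEquiv.symm c)]
  · have := hasState_initial (Q := colorEquiv.symm c) (τ := τ) fun v => rfl
    split_ifs at this ⊢ with h
    · obtain ⟨m, hm, hs⟩ := this
      rw [hm, pow_size_eq (b := 0) (by simpa using hs), pow_zero, mul_one]
    · rw [this]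
      rfl
  · intro Q _ hQ
    refine if_neg fun h => hQ (ext_color (funext fun ⟨v, i⟩ => ?_))
    obtain rfl : i = Fin.last 0 := Subsingleton.elim (α := Fin 1) _ _
    exact h.1 v
  · simp

/-- The sum depends only on the configuration, and satisfies the linear recursion given by the
transfer matrix. -/
theorem stateSum_eq (n : ℕ) : ∀ {i : Fin 7} {τ : SliceState}, τ ∈ sliceStates i →
    stateSum n τ = stateSum n (sliceState i) ∧
    stateSum (n + 1) τ = ∑ j, transferMatrix yVar i j * stateSum n (sliceState j) := by
  -- If the sums at `n` depend only on the configuration, they factor out of each group of states,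
  -- and the remaining weights add up to a matrix entry.
  have key : ∀ n, (∀ i, ∀ τ ∈ sliceStates i, stateSum n τ = stateSum n (sliceState i)) →
      ∀ i, ∀ τ ∈ sliceStates i,
        stateSum (n + 1) τ = ∑ j, transferMatrix yVar i j * stateSum n (sliceState j) := by
    intro n h i τ hτ
    rw [stateSum_succ]
    refine Finset.sum_congr rfl fun j _ => ?_
    rw [← sum_stepWeight hτ, ← List.sum_map_mul_right]
    exact congrArg List.sum (List.map_congr_left fun σ hσ => by rw [h j σ hσ])
  -- The right side of the recursion involves `τ` only through its configuration `i`, so the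
  -- independence passes from `n` to `n + 1`.
  have main : ∀ n, ∀ i, ∀ τ ∈ sliceStates i, stateSum n τ = stateSum n (sliceState i) := by
    intro n
    induction n with
    | zero =>
      intro i τ hτ
      rw [stateSum_zero, stateSum_zero, stepWeight_initial hτ,
        stepWeight_initial (sliceState_mem i)]
    | succ n ih =>
      intro i τ hτ
      rw [key n ih i τ hτ, key n ih i _ (sliceState_mem i)]
  exact fun {i τ} hτ => ⟨main n i τ hτ, key n (main n) i τ hτ⟩

end ColoredPartition

/-! ### The linear system for the seven series -/

open ColoredPartition

theorem coeff_zero_sliceGF (i : Fin 7) : PowerSeries.coeff 0 (sliceGF i) = 0 := by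
  rw [sliceGF, PowerSeries.coeff_mk]

theorem coeff_succ_sliceGF (n : ℕ) (i : Fin 7) :
    PowerSeries.coeff (n + 1) (sliceGF i) = stateSum n (sliceState i) := by
  classical
  rw [sliceGF, PowerSeries.coeff_mk, stateSum, ← Finset.sum_filter]
  simp only [hasState_sliceState_iff]

theorem sliceGF_eq (i : Fin 7) :
    sliceGF i = PowerSeries.X * PowerSeries.C (baseVector yVar i)
      + PowerSeries.X * ∑ j : Fin 7, PowerSeries.C (transferMatrix yVar i j) * sliceGF j := by
  ext n
  obtain _ | n := n
  · simp [coeff_zero_sliceGF]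
  · rw [coeff_succ_sliceGF, map_add, PowerSeries.coeff_succ_X_mul, PowerSeries.coeff_succ_X_mul,
      map_sum]
    simp only [PowerSeries.coeff_C_mul]
    obtain _ | n := n
    · simp [coeff_zero_sliceGF, stateSum_zero, stepWeight_initial (sliceState_mem i)]
    · simp only [coeff_succ_sliceGF, PowerSeries.coeff_C, (stateSum_eq n (sliceState_mem i)).2]
      simp

theorem starGF_eq_sum : starGF = 2 * (sliceGF 0 + 3 * sliceGF 1 + sliceGF 2 + 3 * sliceGF 3
      + 3 * sliceGF 4 + 3 * sliceGF 5 + sliceGF 6) := by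
  -- The multiplicities are the numbers of states per configuration: twice 1, 3, 1, 3, 3, 3, 1.
  have h : starGF = ∑ i, ((sliceStates i).length : Coeffs⟦X⟧) * sliceGF i := by
    ext n
    rw [map_sum]
    simp only [← map_natCast (PowerSeries.C (R := Coeffs)), PowerSeries.coeff_C_mul]
    obtain _ | n := n
    · have : IsEmpty (ColoredPartition (starPath 0) 2) := by
        refine ⟨fun P => ?_⟩
        obtain ⟨_, v, _⟩ := P.nonempty
        exact v.2.elim0
      simp [starGF, coeff_zero_sliceGF]
    · rw [starGF, PowerSeries.coeff_mk, sum_pow_size]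
      refine Finset.sum_congr rfl fun i _ => ?_
      rw [coeff_succ_sliceGF, List.map_congr_left fun σ hσ => (stateSum_eq n hσ).1]
      simp
  rw [h, Fin.sum_univ_seven]
  simp [sliceStates, leafLabels]
  ring

/-! ### Solution of the linear system -/

set_option maxHeartbeats 4000000 in
/-- Elimination in the linear system of the transfer matrix, with denominators cleared. -/
theorem transfer_elimination {R : Type*} [CommRing R] (x y : R) (t : Fin 7 → R)
    (h0 : t 0 = x * y^4 + x * ((y^4 + 1) * t 0 + (3*y^4) * t 1 + (y^4) * t 2 + (3*y^3 + 3*y) * t 3 +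
    (3*y^3) * t 4 + (3*y^2) * t 5 + (y^3) * t 6))
    (h1 : t 1 = x * ((1) * t 1 + (y) * t 4 + (y^2) * t 5))
    (h2 : t 2 = x * ((1) * t 2 + (y) * t 6))
    (h3 : t 3 = x * y^3 + x * ((y^2 + 1) * t 0 + (3*y^2 + 2) * t 1 + (y^2) * t 2 + (y^3 + 4*y + 1) *
    t 3 + (y^3 + 4*y) * t 4 + (3*y^2 + 2*y) * t 5 + (y^2) * t 6))
    (h4 : t 4 = x * ((1) * t 1 + (1) * t 2 + (1) * t 4 + (1) * t 5 + (y) * t 6))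
    (h5 : y * t 5 = x * y^3 + x * ((2*y) * t 0 + (y^2 + 5*y) * t 1 + (y^2 + y) * t 2 + (3*y^2 + 2*y
    + 1) * t 3 + (3*y^2 + 3*y) * t 4 + (y^3 + 2*y^2 + 3*y) * t 5 + (2*y^2) * t 6))
    (h6 : y^2 * t 6 = x * y^3 + x * ((y^2 + 1) * t 0 + (3*y^2 + 3*y) * t 1 + (2*y^2) * t 2 + (3*y^2
    + 3*y) * t 3 + (6*y^2) * t 4 + (6*y^2) * t 5 + (y^3 + y^2) * t 6)) :
    y^2 * ((2 * (t 0 + 3 * t 1 + t 2 + 3 * t 3 + 3 * t 4 + 3 * t 5 + t 6)) *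
      (1 + (-y^4 - y^3 - y^2 - 7*y - 9) * x + (y^7 + y^6 + 5*y^5 + 11*y^4 - 4*y^3 - 6*y^2 + 14*y +
      28) * x^2 + (-y^9 - 3*y^8 + y^7 + 5*y^6 - 22*y^5 - 11*y^4 + 7*y^3 + 54*y^2 - 18*y - 44) * x^3
      + (7*y^9 - 17*y^8 + 2*y^7 + 20*y^6 - 32*y^5 + 45*y^4 + 42*y^3 - 105*y^2 - y + 39) * x^4 +
      (y^11 + 4*y^10 - 24*y^9 + 47*y^8 - 28*y^7 - 62*y^6 + 167*y^5 - 125*y^4 - 50*y^3 + 83*y^2 + 6*y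
      - 19) * x^5 + (y^11 - 24*y^10 + 94*y^9 - 122*y^8 - 61*y^7 + 365*y^6 - 409*y^5 + 116*y^4 +
      116*y^3 - 91*y^2 + 11*y + 4) * x^6 + (-3*y^11 + 23*y^10 - 74*y^9 + 95*y^8 + 45*y^7 - 289*y^6 +
      355*y^5 - 183*y^4 + 18*y^3 + 18*y^2 - 5*y) * x^7)) =
    y^2 *
      ((2*y^4 + 6*y^3 + 6*y^2 + 2*y) * x + (-8*y^7 + 4*y^6 - 28*y^5 + 40*y^4 - 44*y^3 + 4*y^2 -
      16*y) * x^2 + (14*y^9 - 22*y^8 - 4*y^7 + 104*y^6 - 106*y^5 - 32*y^4 + 90*y^3 - 52*y^2 + 40*y)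
      * x^3 + (-8*y^10 - 8*y^9 + 124*y^8 - 204*y^7 + 52*y^6 + 64*y^5 + 16*y^4 - 80*y^3 + 92*y^2 -
      48*y) * x^4 + (-10*y^11 + 4*y^10 + 110*y^9 - 268*y^8 + 112*y^7 + 384*y^6 - 662*y^5 + 468*y^4 -
      120*y^3 - 48*y^2 + 30*y) * x^5 + (16*y^11 - 28*y^10 - 156*y^9 + 656*y^8 - 1028*y^7 + 708*y^6 -
      316*y^4 + 168*y^3 - 12*y^2 - 8*y) * x^6 + (8*y^11 - 58*y^10 + 228*y^9 - 562*y^8 + 852*y^7 -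
      756*y^6 + 340*y^5 - 26*y^4 - 36*y^3 + 10*y^2) * x^7) := by
  -- Once the factors `y` and `y^2` cleared in `h5` and `h6` are restored, the multipliers form a
  -- row vector `m` with `m (1 - x𝓡) = y^2 q · 2(1, 3, 1, 3, 3, 3, 1)` and `m b = y^2 p`.
  linear_combination
    ((2*y^2) + (-2*y^5 + 4*y^4 - 14*y^3 + 4*y^2 + 2) * x + (2*y^7 - 10*y^5 + 20*y^4 + 4*y^3 - 18*y^2
    + 20*y - 14) * x^2 + (-12*y^7 + 48*y^6 - 62*y^5 + 26*y^4 - 12*y^3 + 34*y^2 - 48*y + 26) * x^3 +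
    (-2*y^9 + 38*y^7 - 116*y^6 + 114*y^5 + 24*y^4 - 110*y^3 + 38*y^2 + 36*y - 22) * x^4 + (-2*y^9 +
    42*y^8 - 208*y^7 + 456*y^6 - 474*y^5 + 144*y^4 + 138*y^3 - 114*y^2 + 10*y + 8) * x^5 + (6*y^9 -
    54*y^8 + 206*y^7 - 418*y^6 + 472*y^5 - 274*y^4 + 46*y^3 + 26*y^2 - 10*y) * x^6) * h0 + ((6*y^2)
    + (-6*y^5 + 12*y^4 - 36*y^3 + 6*y^2 + 6*y) * x + (18*y^4 + 30*y^3 - 18*y^2 - 18*y) * x^2 +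
    (6*y^10 - 24*y^9 + 30*y^8 - 6*y^7 + 18*y^6 - 150*y^5 + 378*y^4 - 456*y^3 + 198*y^2 + 6*y) * x^3
    + (-6*y^11 + 12*y^10 + 60*y^9 - 234*y^8 + 234*y^7 + 54*y^6 - 126*y^5 - 204*y^4 + 324*y^3 -
    96*y^2 - 18*y) * x^4 + (-18*y^11 + 144*y^10 - 420*y^9 + 456*y^8 + 204*y^7 - 912*y^6 + 654*y^5 +
    42*y^4 - 180*y^3 + 6*y^2 + 24*y) * x^5 + (24*y^11 - 168*y^10 + 432*y^9 - 390*y^8 - 294*y^7 +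
    942*y^6 - 756*y^5 + 174*y^4 + 66*y^3 - 30*y^2) * x^6) * h1 + ((2*y^2) + (-2*y^5 + 4*y^4 - 8*y^3)
    * x + (-4*y^7 - 2*y^6 + 26*y^5 - 22*y^4 + 18*y^3 - 12*y^2) * x^2 + (6*y^10 - 22*y^9 + 18*y^8 +
    40*y^7 - 100*y^6 + 68*y^5 + 50*y^4 - 124*y^3 + 64*y^2) * x^3 + (-8*y^11 + 34*y^10 - 24*y^9 -
    98*y^8 + 208*y^7 - 142*y^6 + 68*y^5 - 144*y^4 + 168*y^3 - 62*y^2) * x^4 + (-2*y^12 + 8*y^11 +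
    12*y^10 - 102*y^9 + 116*y^8 + 246*y^7 - 798*y^6 + 876*y^5 - 432*y^4 + 68*y^3 + 8*y^2) * x^5 +
    (10*y^12 - 68*y^11 + 166*y^10 - 124*y^9 - 178*y^8 + 442*y^7 - 350*y^6 + 96*y^5 + 16*y^4 -
    10*y^3) * x^6) * h2 + ((6*y^2) + (-6*y^6 + 6*y^5 - 6*y^4 + 6*y^3 - 30*y^2 + 12*y) * x + (6*y^8 -
    6*y^7 + 6*y^6 + 18*y^5 - 36*y^4 - 36*y^3 + 108*y^2 - 48*y) * x^2 + (-18*y^8 + 84*y^7 - 126*y^6 +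
    6*y^5 + 96*y^4 + 36*y^3 - 138*y^2 + 60*y) * x^3 + (-6*y^10 - 12*y^9 + 126*y^8 - 234*y^7 + 54*y^6
    + 312*y^5 - 372*y^4 + 114*y^3 + 42*y^2 - 24*y) * x^4 + (-6*y^10 + 78*y^9 - 282*y^8 + 438*y^7 -
    270*y^6 - 54*y^5 + 162*y^4 - 78*y^3 + 12*y^2) * x^5 + (18*y^10 - 108*y^9 + 264*y^8 - 330*y^7 +
    210*y^6 - 48*y^5 - 12*y^4 + 6*y^3) * x^6) * h3 + ((6*y^2) + (-6*y^6 + 6*y^5 - 6*y^4 + 6*y^3 -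
    18*y^2) * x + (6*y^8 - 6*y^7 - 6*y^6 + 24*y^5 + 18*y^4 - 78*y^3 + 54*y^2) * x^2 + (12*y^9 -
    72*y^8 + 126*y^7 - 72*y^6 + 54*y^5 - 204*y^4 + 246*y^3 - 90*y^2) * x^3 + (18*y^10 - 120*y^9 +
    246*y^8 - 42*y^7 - 498*y^6 + 654*y^5 - 234*y^4 - 72*y^3 + 48*y^2) * x^4 + (-12*y^12 + 84*y^11 -
    240*y^10 + 342*y^9 - 132*y^8 - 438*y^7 + 936*y^6 - 870*y^5 + 408*y^4 - 78*y^3) * x^5 + (6*y^12 -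
    42*y^11 + 126*y^10 - 216*y^9 + 240*y^8 - 186*y^7 + 102*y^6 - 36*y^5 + 6*y^4) * x^6) * h4 +
    ((6*y) + (-6*y^5 - 6*y^4 + 30*y^3 - 18*y^2 - 18*y) * x + (6*y^8 - 18*y^7 + 6*y^6 + 66*y^5 -
    66*y^4 - 42*y^3 + 30*y^2 + 30*y) * x^2 + (-6*y^9 + 6*y^8 + 30*y^7 - 18*y^6 - 90*y^5 + 60*y^4 +
    78*y^3 - 42*y^2 - 18*y) * x^3 + (-6*y^9 + 30*y^8 - 24*y^7 - 150*y^6 + 402*y^5 - 384*y^4 +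
    144*y^3 - 12*y^2) * x^4 + (12*y^10 - 66*y^9 + 138*y^8 - 132*y^7 + 66*y^6 - 66*y^5 + 102*y^4 -
    72*y^3 + 18*y^2) * x^5 + (-6*y^10 + 42*y^9 - 114*y^8 + 150*y^7 - 90*y^6 + 6*y^5 + 18*y^4 -
    6*y^3) * x^6) * h5 + ((2) + (-2*y^4 + 4*y^2 + 8*y - 16) * x + (2*y^7 - 6*y^6 - 8*y^4 + 64*y^3 -
    68*y^2 - 20*y + 40) * x^2 + (-2*y^9 + 16*y^8 - 38*y^7 + 2*y^6 + 110*y^5 - 80*y^4 - 132*y^3 +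
    148*y^2 + 24*y - 48) * x^3 + (-2*y^10 + 22*y^9 - 84*y^8 + 106*y^7 + 94*y^6 - 354*y^5 + 204*y^4 +
    172*y^3 - 186*y^2 - 2*y + 30) * x^4 + (12*y^10 - 82*y^9 + 196*y^8 - 106*y^7 - 350*y^6 + 684*y^5
    - 402*y^4 - 52*y^3 + 128*y^2 - 20*y - 8) * x^5 + (-10*y^10 + 62*y^9 - 128*y^8 + 36*y^7 + 260*y^6
    - 440*y^5 + 288*y^4 - 52*y^3 - 26*y^2 + 10*y) * x^6) * h6

/-! ### Degrees of `p` and `q`, and the closed form -/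

theorem natDegree_starNum : (starNum yVar).natDegree = 7 := by
  have h : 8*yVar^11 - 58*yVar^10 + 228*yVar^9 - 562*yVar^8 + 852*yVar^7 - 756*yVar^6 +
      340*yVar^5 - 26*yVar^4 - 36*yVar^3 + 10*yVar^2 ≠ 0 := by
    let p : Polynomial ℚ := 8*.X^11 - 58*.X^10 + 228*.X^9 - 562*.X^8 + 852*.X^7 - 756*.X^6 +
      340*.X^5 - 26*.X^4 - 36*.X^3 + 10*.X^2
    have hp : p ≠ 0 := by
      intro h0
      -- The leading coefficient vanishes at `0` and at `1`, but not at `2`.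
      have := congrArg (Polynomial.eval 2) h0
      norm_num [p] at this
    simpa [p, map_ofNat] using RatFunc.algebraMap_ne_zero hp
  unfold starNum
  compute_degree!

theorem natDegree_starDen : (starDen yVar).natDegree = 7 := by
  have h : -3*yVar^11 + 23*yVar^10 - 74*yVar^9 + 95*yVar^8 + 45*yVar^7 - 289*yVar^6 +
      355*yVar^5 - 183*yVar^4 + 18*yVar^3 + 18*yVar^2 - 5*yVar ≠ 0 := by
    let p : Polynomial ℚ := -3*.X^11 + 23*.X^10 - 74*.X^9 + 95*.X^8 + 45*.X^7 - 289*.X^6 +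
      355*.X^5 - 183*.X^4 + 18*.X^3 + 18*.X^2 - 5*.X
    have hp : p ≠ 0 := by
      intro h0
      have := congrArg (Polynomial.eval 2) h0
      norm_num [p] at this
    simpa [p, map_ofNat] using RatFunc.algebraMap_ne_zero hp
  unfold starDen
  compute_degree!
  simpa using h

/-- Serves to clear the denominators `y` and `y^2` in the last two rows of the matrix, so that the
elimination takes place in a commutative ring without division. -/
theorem C_mul_sliceGF_eq (i : Fin 7) (a : Coeffs) {b : Coeffs} {r : Fin 7 → Coeffs}
    (hb : a * baseVector yVar i = b) (hr : ∀ j, a * transferMatrix yVar i j = r j) :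
    PowerSeries.C a * sliceGF i = PowerSeries.X * PowerSeries.C b + PowerSeries.X *
      ∑ j : Fin 7, PowerSeries.C (r j) * sliceGF j := by
  conv_lhs => rw [sliceGF_eq i]
  simp only [← hb, ← hr, map_mul, mul_add, Finset.mul_sum]
  congr 1
  · ring
  · exact Finset.sum_congr rfl fun j _ => by ring

set_option maxHeartbeats 400000 in
theorem starGF_mul_starDen :
    starGF * (starDen yVar : Coeffs⟦X⟧) = (starNum yVar : Coeffs⟦X⟧) := by
  have hy := yVar_ne_zero
  have hC : PowerSeries.C yVar ^ 2 ≠ 0 :=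
    pow_ne_zero 2 ((map_ne_zero_iff _ PowerSeries.C_injective).2 hy)
  have h5 := C_mul_sliceGF_eq 5 yVar (b := yVar^3) (r := ![2*yVar, yVar^2 + 5*yVar, yVar^2 + yVar,
    3*yVar^2 + 2*yVar + 1, 3*yVar^2 + 3*yVar, yVar^3 + 2*yVar^2 + 3*yVar, 2*yVar^2])
    (by simp [baseVector]; ring)
    (by intro j; fin_cases j <;> simp [transferMatrix] <;> field_simp)
  have h6 := C_mul_sliceGF_eq 6 (yVar^2) (b := yVar^3) (r := ![yVar^2 + 1, 3*yVar^2 + 3*yVar, 2*yVar^2,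
    3*yVar^2 + 3*yVar, 6*yVar^2, 6*yVar^2, yVar^3 + yVar^2])
    (by simp [baseVector]; ring)
    (by intro j; fin_cases j <;> simp [transferMatrix] <;> field_simp)
  have h0 := sliceGF_eq 0
  have h1 := sliceGF_eq 1
  have h2 := sliceGF_eq 2
  have h3 := sliceGF_eq 3
  have h4 := sliceGF_eq 4
  simp [Fin.sum_univ_seven, transferMatrix, baseVector, map_ofNat] at h0 h1 h2 h3 h4 h5 h6
  refine mul_left_cancel₀ hC ?_
  have key := transfer_elimination (PowerSeries.X : Coeffs⟦X⟧) (PowerSeries.C yVar) sliceGF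
    (by linear_combination h0) (by linear_combination h1) (by linear_combination h2)
    (by linear_combination h3) (by linear_combination h4) (by linear_combination h5)
    (by linear_combination h6)
  rw [← starGF_eq_sum] at key
  simp only [starNum, starDen, Polynomial.coe_add, Polynomial.coe_mul, Polynomial.coe_pow,
    Polynomial.coe_C, Polynomial.coe_X, Polynomial.coe_one]
  simp only [map_add, map_sub, map_neg, map_mul, map_pow, map_ofNat]
  exact key

theorem starGF_eq_div : starGF = (starNum yVar : Coeffs⟦X⟧) * (starDen yVar : Coeffs⟦X⟧)⁻¹ := by
  rw [PowerSeries.eq_mul_inv_iff_mul_eq, starGF_mul_starDen]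
  -- The inverse is a true one because `q` has constant coefficient `1` in `x`.
  simp [starDen]

theorem mainTheorem11 :
    -- `T = p / q`, with `p` and `q` of degree 7 in `x`
    (starNum yVar).natDegree = 7 ∧ (starDen yVar).natDegree = 7 ∧
    starGF = (starNum yVar : Coeffs⟦X⟧) * (starDen yVar : Coeffs⟦X⟧)⁻¹ ∧
    -- `T = 2 (T₁ + 3 T₂ + T₃ + 3 T₄ + 3 T₅ + 3 T₆ + T₇)`
    starGF = 2 * (sliceGF 0 + 3 * sliceGF 1 + sliceGF 2 + 3 * sliceGF 3 + 3 * sliceGF 4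
      + 3 * sliceGF 5 + sliceGF 6) ∧
    -- `t = b + x 𝓡 t`
    (∀ i : Fin 7, sliceGF i = PowerSeries.X * PowerSeries.C (baseVector yVar i)
      + PowerSeries.X * ∑ j : Fin 7, PowerSeries.C (transferMatrix yVar i j) * sliceGF j) := by
  exact ⟨natDegree_starNum, natDegree_starDen, starGF_eq_div, starGF_eq_sum, sliceGF_eq⟩
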